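/- Let $I\ge 0$, let $K\subset\Omega\subset\mathbb R^I$ with $K$ compact and $\Omega$ open, and put $r=\lfloor I/2\rfloor+2$. For $x\in\mathbb R^D$ let $U_x=\bigotimes_{d=1}^D R_Y(2x_d)$ be the tensor product encoding on $D$ qubits, where $R_Y(\varphi)=\begin{pmatrix}\cos(\varphi/2)&-\sin(\varphi/2)\\ \sin(\varphi/2)&\cos(\varphi/2)\end{pmatrix}$, and for a $D$-qubit state $\psi$ let $\mathcal T^{-1}(\psi)=\{x\in\mathbb R^D: U_x|0\rangle^{\otimes D}=\psi\}$ be the set of classical vectors that are encoded as $\psi$. There is a constant $c>0$, depending only on $I,K,\Omega$, such that the following holds for every $D\ge 1$. Let $H$ be a unitary operator on $D$ qubits (for instance a variational quantum circuit $H_\theta$ with any parameters $\theta$). For each network input $y\in\Omega$ let $|z(y)\rangle=\bigotimes_{d=1}^D|z_d(y)\rangle$ be a product of one-qubit unit vectors (the target state), and let $\hat x:\mathbb R^I\to\mathbb R^D$ be a target that satisfies $\hat x(y)\in\mathcal T^{-1}(H^{-1}|z(y)\rangle)$ for all $y\in\Omega$, is $r$ times continuously differentiable on $\Omega$, and has finite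 norm $$\|\hat x\|_{r,\Omega}=\sup_{y\in\Omega}\|\hat x(y)\|_1+\sum_{k=1}^{r}\sup_{y\in\Omega}\|D^k\hat x(y)\|,$$ where the derivatives are measured in the operator norm from the Euclidean norm on $\mathbb R^I$ to the $\ell_1$ norm on $\mathbb R^D$ (a constant target vector $\hat x$ is allowed). Then there is a two-layer feed-forward network $f_{\mathrm{dense}}(y)=A\tanh(Wy+b)+a$ with a dense layer of $D$ neurons, one per qubit, with $\tanh$ applied to each of them ($W\in\mathbb R^{D\times I}$, $A\in\mathbb R^{D\times D}$, $a,b\in\mathbb R^D$), such that $$\|\hat x(y)-f_{\mathrm{dense}}(y)\|_1\le\frac{C}{\sqrt D}\quad\text{for all }y\in K,\qquad C=c\,\|\hat x\|_{r,\Omega}.$$ -/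

import Mathlib

open scoped Matrix ENNReal

noncomputable section

/-- The index set of the computational basis of `D` qubits: bit strings of length `D`. -/
abbrev Bits (D : ℕ) : Type := Fin D → Fin 2

/-- The rotation gate `R_Y(φ)`. -/
def rotY (φ : ℝ) : Matrix (Fin 2) (Fin 2) ℂ :=
  !![(Real.cos (φ / 2) : ℂ), -(Real.sin (φ / 2) : ℂ);
     (Real.sin (φ / 2) : ℂ), (Real.cos (φ / 2) : ℂ)]

/-- The operator `U_x = R_Y(2 x₁) ⊗ ⋯ ⊗ R_Y(2 x_D)` on `D` qubits, written in the computational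
basis (the entries of a tensor product of matrices are the products of the entries). -/
def tensorProductEncoding {D : ℕ} (x : PiLp 1 (fun _ : Fin D => ℝ)) :
    Matrix (Bits D) (Bits D) ℂ :=
  fun i j => ∏ d, rotY (2 * x d) (i d) (j d)

/-- The basis state `|0⟩ ⊗ ⋯ ⊗ |0⟩`. -/
def zeroKet (D : ℕ) : Bits D → ℂ := Pi.single (fun _ => 0) 1

/-- The product state `|z⟩ = |z₁⟩ ⊗ ⋯ ⊗ |z_D⟩`. -/
def productState {D : ℕ} (z : Fin D → EuclideanSpace ℂ (Fin 2)) : Bits D → ℂ :=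
  fun i => ∏ d, z d (i d)

/-- The preimage `T⁻¹(ψ)`: all classical vectors `x` of rotation angles whose encoding
`U_x |0⟩^{⊗D}` is the state `ψ`. -/
def encodingPreimage {D : ℕ} (ψ : Bits D → ℂ) : Set (PiLp 1 (fun _ : Fin D => ℝ)) :=
  {x | tensorProductEncoding x *ᵥ zeroKet D = ψ}

/-- A two-layer feed-forward network with `I` inputs, a dense layer of `D` neurons (one per
qubit), and an affine output layer that produces the `D` rotation angles of the qubits. -/
structure DenseNetwork (I D : ℕ) where
  /-- weights of the dense layer -/
  weight : Matrix (Fin D) (Fin I) ℝ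
  /-- biases of the dense layer -/
  bias : Fin D → ℝ
  /-- weights of the output layer -/
  outWeight : Matrix (Fin D) (Fin D) ℝ
  /-- biases of the output layer -/
  outBias : Fin D → ℝ

/-- The function computed by the network: `tanh` is applied to every neuron of the dense layer. -/
def DenseNetwork.eval {I D : ℕ} (f : DenseNetwork I D) (y : EuclideanSpace ℝ (Fin I)) :
    PiLp 1 (fun _ : Fin D => ℝ) :=
  WithLp.toLp 1
    (f.outWeight *ᵥ (fun d => Real.tanh ((f.weight *ᵥ WithLp.ofLp y) d + f.bias d)) + f.outBias)

/-- `‖g‖_∞ + ∑_{1 ≤ k ≤ r} ‖D^k g‖_∞` on `Ω`, as an extended nonnegative number. -/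
def smoothnessNorm {E F : Type*} [NormedAddCommGroup E] [NormedSpace ℝ E]
    [NormedAddCommGroup F] [NormedSpace ℝ F] (r : ℕ) (Ω : Set E) (g : E → F) : ℝ≥0∞ :=
  ∑ k ∈ Finset.range (r + 1), ⨆ y ∈ Ω, ‖iteratedFDeriv ℝ k g y‖ₑ

end

/-! ### Derivatives of `tanh` -/

/-! The theorem is a Jackson-type estimate for functions with values in a Banach space. A `C^r`
function is approximated by a polynomial of degree `m`, of order `n`, in each of the `I` variables
with error of order `n⁻ʳ`. The argument only uses norms in the target space, so the constant does
not depend on `D` (`exists_polynomial_approx_of_kernel`).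

Such a polynomial has `(m + 1)^I` vector coefficients. Mixed differences of `tanh (b + h ⟨j, x⟩)` in
the weight tend, after scaling, to the monomials, and all monomials share the same `(m + 1)^I`
neurons (`exists_tanh_sum_approx`). The vector coefficients go into the output layer, so the neuron
count does not grow with the number of outputs.

Taking `n` of order `D^(1/I)` gives the error `D^(-r/I)`, which is at most of order `D^(-1/2)`
because `I ≤ 2 * r`. A cutoff equal to one on `K` reduces the case of an open `Ω` to compact
support. -/

theorem Real.hasDerivAt_tanh_one_sub_sq (x : ℝ) :
    HasDerivAt Real.tanh (1 - Real.tanh x ^ 2) x := by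
  have h := (Real.hasDerivAt_sinh x).div (Real.hasDerivAt_cosh x) (Real.cosh_pos x).ne'
  have e : Real.tanh = Real.sinh / Real.cosh := by
    funext y; simp [Real.tanh_eq_sinh_div_cosh]
  rw [← e] at h
  refine h.congr_deriv ?_
  have := (Real.cosh_pos x).ne'
  rw [Real.tanh_eq_sinh_div_cosh]
  field_simp

theorem Real.contDiff_tanh' {n : WithTop ℕ∞} : ContDiff ℝ n Real.tanh := by
  have e : Real.tanh = fun x => Real.sinh x / Real.cosh x := by
    funext y; simp [Real.tanh_eq_sinh_div_cosh]
  rw [e]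
  exact Real.contDiff_sinh.div Real.contDiff_cosh fun x => (Real.cosh_pos x).ne'

/-- Since `tanh' = 1 - tanh²`, differentiation acts on polynomials in `tanh` by `p ↦ p' (1 - X²)`.
This raises the degree by exactly one, so no derivative is the zero polynomial in `tanh`. -/
theorem exists_polynomial_iteratedDeriv_tanh (l : ℕ) :
    ∃ p : Polynomial ℝ, p.natDegree = l + 1 ∧
      iteratedDeriv l Real.tanh = fun x => p.eval (Real.tanh x) := by
  induction l with
  | zero => exact ⟨Polynomial.X, by simp, by simp⟩
  | succ l ih =>
    obtain ⟨p, hp, hd⟩ := ih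
    refine ⟨p.derivative * (1 - Polynomial.X ^ 2), ?_, ?_⟩
    · have h1 : p.derivative.natDegree = l := by
        rw [Polynomial.natDegree_derivative, hp]; simp
      have h2 : (1 - Polynomial.X ^ 2 : Polynomial ℝ).natDegree = 2 := by
        compute_degree!
      have h3 : p.derivative ≠ 0 := by
        intro h
        have := Polynomial.derivative_eq_zero.1 h
        omega
      have h4 : (1 - Polynomial.X ^ 2 : Polynomial ℝ) ≠ 0 := by
        intro h; rw [h] at h2; simp at h2
      rw [Polynomial.natDegree_mul h3 h4, h1, h2]
    · rw [iteratedDeriv_succ, hd]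
      funext x
      have := (p.hasDerivAt (Real.tanh x)).comp x (Real.hasDerivAt_tanh_one_sub_sq x)
      simpa [Function.comp_def] using this.deriv

/-- Finitely many nonzero polynomials have finitely many roots, while `tanh` takes infinitely many
values. At such a bias every Taylor coefficient of order at most `L` can be divided by. -/
theorem exists_forall_iteratedDeriv_tanh_ne_zero (L : ℕ) :
    ∃ b : ℝ, ∀ l ≤ L, iteratedDeriv l Real.tanh b ≠ 0 := by
  choose p hp hd using exists_polynomial_iteratedDeriv_tanh
  set P : Polynomial ℝ := ∏ l ∈ Finset.range (L + 1), p l with hP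
  have hP0 : P ≠ 0 := by
    refine Finset.prod_ne_zero_iff.2 fun l _ h => ?_
    have := hp l
    rw [h] at this; simp at this
  have hinf : (Set.range Real.tanh).Infinite := Set.infinite_range_of_injective Real.tanh_injective
  obtain ⟨_, ⟨b, rfl⟩, hb⟩ := hinf.exists_notMem_finset P.roots.toFinset
  refine ⟨b, fun l hl h => hb ?_⟩
  rw [Multiset.mem_toFinset, Polynomial.mem_roots hP0, Polynomial.IsRoot.def, hP,
    Polynomial.eval_prod]
  refine Finset.prod_eq_zero (Finset.mem_range.2 (Nat.lt_succ_of_le hl)) ?_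
  rw [hd] at h
  exact h

/-! ### Finite differences -/

/-- The coefficients of the forward difference of order `a` with unit step. -/
noncomputable def diffCoeff (a j : ℕ) : ℝ := (-1) ^ (a - j) * a.choose j

/-- The sum runs to a common bound `m`, so that differences of all orders use the same nodes; beyond
`a` the binomial coefficient vanishes. -/
theorem sum_diffCoeff_mul_pow {a m : ℕ} (ham : a ≤ m) (l : ℕ) :
    ∑ j : Fin (m + 1), diffCoeff a j * (j : ℝ) ^ l = (fwdDiff (1 : ℝ))^[a] (fun x => x ^ l) 0 := by
  rw [fwdDiff_iter_eq_sum_shift, Fin.sum_univ_eq_sum_range (fun j => diffCoeff a j * (j : ℝ) ^ l)]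
  symm
  refine Finset.sum_subset_zero_on_sdiff (Finset.range_mono (by omega)) ?_ ?_
  · intro j hj
    simp only [Finset.mem_sdiff, Finset.mem_range] at hj
    simp [diffCoeff, Nat.choose_eq_zero_of_lt (show a < j by omega)]
  · intro j _
    simp [diffCoeff]

theorem sum_diffCoeff_mul_pow_of_lt {a m l : ℕ} (ham : a ≤ m) (hl : l < a) :
    ∑ j : Fin (m + 1), diffCoeff a j * (j : ℝ) ^ l = 0 := by
  rw [sum_diffCoeff_mul_pow ham, fwdDiff_iter_pow_eq_zero_of_lt hl]; rfl

theorem sum_diffCoeff_mul_pow_self {a m : ℕ} (ham : a ≤ m) :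
    ∑ j : Fin (m + 1), diffCoeff a j * (j : ℝ) ^ a = a.factorial := by
  rw [sum_diffCoeff_mul_pow ham, fwdDiff_iter_eq_factorial]; rfl

theorem exists_lt_of_sum_le {ι : Type*} [Fintype ι] {k α : ι → ℕ} (h : ∑ i, k i ≤ ∑ i, α i) (hne : k ≠ α) :
    ∃ i, k i < α i := by
  by_contra! hc
  refine hne (funext fun i => ?_)
  have := (Finset.sum_eq_sum_iff_of_le (s := Finset.univ) fun i _ => hc i).1
    (le_antisymm (Finset.sum_le_sum fun i _ => hc i) h)
  exact (this i (Finset.mem_univ i)).symm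

/-! ### Monomials as limits of mixed differences of neurons -/

section Monomials

variable {ι : Type*} [Fintype ι] [DecidableEq ι] {m : ℕ}

/-- The coefficients of the mixed forward difference of multi-order `α`. -/
noncomputable def mixedDiffCoeff (α j : ι → Fin (m + 1)) : ℝ := ∏ i, diffCoeff (α i) (j i)

/-- The multinomial expansion makes the difference factor over the coordinates. A factor vanishes
when `k i < α i`, so among exponents of total degree at most that of `α` only `k = α` survives. -/
theorem sum_mixedDiffCoeff_mul_pow (α : ι → Fin (m + 1)) (x : ι → ℝ) (l : ℕ) :
    ∑ j : ι → Fin (m + 1), mixedDiffCoeff α j * (∑ i, (j i : ℝ) * x i) ^ l =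
      ∑ k ∈ Finset.univ.piAntidiag l, (Nat.multinomial Finset.univ k : ℝ) *
        ((∏ i, x i ^ k i) * ∏ i, ∑ s : Fin (m + 1), diffCoeff (α i) s * (s : ℝ) ^ k i) := by
  simp_rw [Finset.sum_pow_eq_sum_piAntidiag, Finset.mul_sum]
  rw [Finset.sum_comm]
  refine Finset.sum_congr rfl fun k _ => ?_
  rw [Finset.prod_univ_sum, Fintype.piFinset_univ, Finset.mul_sum, Finset.mul_sum]
  refine Finset.sum_congr rfl fun j _ => ?_
  simp_rw [mixedDiffCoeff, mul_pow, Finset.prod_mul_distrib]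
  ring

theorem sum_mixedDiffCoeff_mul_pow_of_lt (α : ι → Fin (m + 1)) (x : ι → ℝ) {l : ℕ}
    (hl : l < ∑ i, (α i : ℕ)) :
    ∑ j : ι → Fin (m + 1), mixedDiffCoeff α j * (∑ i, (j i : ℝ) * x i) ^ l = 0 := by
  rw [sum_mixedDiffCoeff_mul_pow]
  refine Finset.sum_eq_zero fun k hk => ?_
  rw [Finset.mem_piAntidiag] at hk
  obtain ⟨i, hi⟩ := exists_lt_of_sum_le (k := k) (α := fun i => (α i : ℕ)) (by rw [hk.1]; exact hl.le)
    (by rintro rfl; exact hl.ne' hk.1)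
  have h0 : ∏ i, ∑ s : Fin (m + 1), diffCoeff (α i) s * (s : ℝ) ^ k i = 0 :=
    Finset.prod_eq_zero (Finset.mem_univ i)
      (sum_diffCoeff_mul_pow_of_lt (Nat.le_of_lt_succ (α i).2) hi)
  rw [h0, mul_zero, mul_zero]

theorem sum_mixedDiffCoeff_mul_pow_self (α : ι → Fin (m + 1)) (x : ι → ℝ) :
    ∑ j : ι → Fin (m + 1), mixedDiffCoeff α j * (∑ i, (j i : ℝ) * x i) ^ (∑ i, (α i : ℕ)) =
      (∑ i, (α i : ℕ)).factorial * ∏ i, x i ^ (α i : ℕ) := by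
  rw [sum_mixedDiffCoeff_mul_pow, Finset.sum_eq_single (fun i => (α i : ℕ))]
  · simp_rw [fun i => sum_diffCoeff_mul_pow_self (Nat.le_of_lt_succ (α i).2)]
    rw [← Nat.multinomial_spec Finset.univ (fun i => (α i : ℕ))]
    push_cast
    ring
  · intro k hk hne
    rw [Finset.mem_piAntidiag] at hk
    obtain ⟨i, hi⟩ := exists_lt_of_sum_le (k := k) (α := fun i => (α i : ℕ)) hk.1.le hne
    have h0 : ∏ i, ∑ s : Fin (m + 1), diffCoeff (α i) s * (s : ℝ) ^ k i = 0 :=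
      Finset.prod_eq_zero (Finset.mem_univ i)
        (sum_diffCoeff_mul_pow_of_lt (Nat.le_of_lt_succ (α i).2) hi)
    rw [h0, mul_zero, mul_zero]
  · intro h
    exact absurd (Finset.mem_piAntidiag.2 ⟨rfl, by simp⟩) h

open Filter Topology

/-- The mixed finite difference of order `α` in the weight of a `tanh` neuron, after division by
the power of the step, tends to a multiple of the monomial of exponent `α`. -/
theorem eventually_abs_mixedDiff_tanh_sub_le (α : ι → Fin (m + 1)) (b R : ℝ) {ε : ℝ} (hε : 0 < ε) :
    ∀ᶠ h in 𝓝[>] (0 : ℝ), ∀ x : ι → ℝ, (∀ i, |x i| ≤ R) →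
      |(∑ j : ι → Fin (m + 1), mixedDiffCoeff α j * h⁻¹ ^ (∑ i, (α i : ℕ)) *
          Real.tanh (b + h * ∑ i, (j i : ℝ) * x i)) -
        iteratedDeriv (∑ i, (α i : ℕ)) Real.tanh b * ∏ i, x i ^ (α i : ℕ)| ≤ ε := by
  set L := ∑ i, (α i : ℕ) with hL
  set B : ℝ := ∑ j : ι → Fin (m + 1), |mixedDiffCoeff α j| * (∑ i, (j i : ℝ) * |R|) ^ L with hB
  have hB0 : 0 ≤ B := by positivity
  -- The Peano remainders add up to at most `δ * B`, since `h⁻¹ ^ L` cancels the `h ^ L` of each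
  -- one.
  set δ := ε / (B + 1) with hδ
  have hδ0 : 0 < δ := by positivity
  have ht := (taylor_isLittleO_univ (x₀ := b) (n := L) (Real.contDiff_tanh' (n := L))).def hδ0
  obtain ⟨η, hη, hball⟩ := Metric.eventually_nhds_iff.1 ht
  set A : ℝ := ∑ i : ι, (m : ℝ) * |R| with hA
  have hA0 : 0 ≤ A := by positivity
  have hsmall : ∀ᶠ h in 𝓝[>] (0 : ℝ), h * A < η := by
    have : Tendsto (fun h : ℝ => h * A) (𝓝[>] 0) (𝓝 (0 * A)) :=
      (tendsto_id.mul_const A).mono_left nhdsWithin_le_nhds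
    rw [zero_mul] at this
    exact this.eventually (gt_mem_nhds hη)
  filter_upwards [hsmall, self_mem_nhdsWithin] with h hh hpos x hx
  have hpos : 0 < h := hpos
  have hx' : ∀ i, |x i| ≤ |R| := fun i => (hx i).trans (le_abs_self R)
  have hub : ∀ j : ι → Fin (m + 1), |∑ i, (j i : ℝ) * x i| ≤ ∑ i, (j i : ℝ) * |R| := by
    intro j
    refine (Finset.abs_sum_le_sum_abs _ _).trans (Finset.sum_le_sum fun i _ => ?_)
    rw [abs_mul, abs_of_nonneg (by positivity : (0 : ℝ) ≤ (j i : ℝ))]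
    exact mul_le_mul_of_nonneg_left (hx' i) (by positivity)
  have hubA : ∀ j : ι → Fin (m + 1), ∑ i, (j i : ℝ) * |R| ≤ A := by
    intro j
    refine Finset.sum_le_sum fun i _ => mul_le_mul_of_nonneg_right ?_ (abs_nonneg R)
    exact_mod_cast Nat.le_of_lt_succ (j i).2
  set rem : (ι → Fin (m + 1)) → ℝ := fun j => Real.tanh (b + h * ∑ i, (j i : ℝ) * x i) -
    taylorWithinEval Real.tanh L Set.univ b (b + h * ∑ i, (j i : ℝ) * x i) with hrem
  have hrem_le : ∀ j, |rem j| ≤ δ * (h ^ L * (∑ i, (j i : ℝ) * |R|) ^ L) := by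
    intro j
    have h1 : dist (b + h * ∑ i, (j i : ℝ) * x i) b < η := by
      rw [Real.dist_eq, add_sub_cancel_left, abs_mul, abs_of_pos hpos]
      exact (mul_le_mul_of_nonneg_left ((hub j).trans (hubA j)) hpos.le).trans_lt hh
    have h2 := hball h1
    rw [add_sub_cancel_left, Real.norm_eq_abs, Real.norm_eq_abs, abs_pow, abs_mul, abs_of_pos hpos,
      mul_pow] at h2
    refine h2.trans ?_
    have := hub j
    gcongr
  -- On the Taylor polynomial the difference is exact: it annihilates the orders below `L` and
  -- leaves the monomial at order `L`.
  have hmain : ∑ j : ι → Fin (m + 1), mixedDiffCoeff α j * h⁻¹ ^ L *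
      taylorWithinEval Real.tanh L Set.univ b (b + h * ∑ i, (j i : ℝ) * x i) =
      iteratedDeriv L Real.tanh b * ∏ i, x i ^ (α i : ℕ) := by
    simp_rw [taylor_within_apply, Finset.mul_sum, iteratedDerivWithin_univ]
    rw [Finset.sum_comm, Finset.sum_range_succ, Finset.sum_eq_zero, zero_add]
    · have := sum_mixedDiffCoeff_mul_pow_self α x
      rw [← hL] at this
      have hf : (L.factorial : ℝ) ≠ 0 := by positivity
      rw [show (iteratedDeriv L Real.tanh b * ∏ i, x i ^ (α i : ℕ)) = (L.factorial : ℝ)⁻¹ *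
        iteratedDeriv L Real.tanh b * (L.factorial * ∏ i, x i ^ (α i : ℕ)) by field_simp, ← this,
        Finset.mul_sum]
      refine Finset.sum_congr rfl fun j _ => ?_
      rw [smul_eq_mul, add_sub_cancel_left, ← Finset.mul_sum, mul_pow, inv_pow]
      field_simp
    · intro l hl
      have := sum_mixedDiffCoeff_mul_pow_of_lt α x (Finset.mem_range.1 hl)
      rw [← mul_zero ((l.factorial : ℝ)⁻¹ * iteratedDeriv l Real.tanh b * h⁻¹ ^ L * h ^ l), ← this,
        Finset.mul_sum]
      refine Finset.sum_congr rfl fun j _ => ?_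
      rw [smul_eq_mul, add_sub_cancel_left, ← Finset.mul_sum, mul_pow]
      ring
  rw [← hmain, ← Finset.sum_sub_distrib]
  calc |∑ j, (mixedDiffCoeff α j * h⁻¹ ^ L * Real.tanh (b + h * ∑ i, (j i : ℝ) * x i) -
        mixedDiffCoeff α j * h⁻¹ ^ L *
          taylorWithinEval Real.tanh L Set.univ b (b + h * ∑ i, (j i : ℝ) * x i))|
      = |∑ j, mixedDiffCoeff α j * h⁻¹ ^ L * rem j| := by simp_rw [hrem, mul_sub]
    _ ≤ ∑ j, |mixedDiffCoeff α j| * (δ * (∑ i, (j i : ℝ) * |R|) ^ L) := by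
        refine (Finset.abs_sum_le_sum_abs _ _).trans (Finset.sum_le_sum fun j _ => ?_)
        rw [abs_mul, abs_mul, mul_assoc]
        refine mul_le_mul_of_nonneg_left ?_ (abs_nonneg _)
        rw [abs_of_nonneg (by positivity : 0 ≤ h⁻¹ ^ L)]
        refine (mul_le_mul_of_nonneg_left (hrem_le j) (by positivity)).trans_eq ?_
        generalize (∑ i, (j i : ℝ) * |R|) ^ L = q
        rw [inv_pow]
        field_simp
    _ = δ * B := by
        rw [hB, Finset.mul_sum]
        exact Finset.sum_congr rfl fun j _ => mul_left_comm _ _ _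
    _ ≤ ε := by
        rw [hδ, div_mul_eq_mul_div, div_le_iff₀ (by positivity)]
        nlinarith

/-- Every polynomial of degree at most `m` in each variable, with coefficients in a normed space,
is on a cube a uniform limit of sums of `(m + 1) ^ #ι` neurons. -/
theorem exists_tanh_sum_approx {F : Type*} [NormedAddCommGroup F] [NormedSpace ℝ F]
    (c : (ι → Fin (m + 1)) → F) (R : ℝ) {ε : ℝ} (hε : 0 < ε) :
    ∃ (w : (ι → Fin (m + 1)) → ι → ℝ) (b : ℝ) (a : (ι → Fin (m + 1)) → F),
      ∀ x : ι → ℝ, (∀ i, |x i| ≤ R) →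
        ‖(∑ α, (∏ i, x i ^ (α i : ℕ)) • c α) - ∑ j, Real.tanh ((∑ i, w j i * x i) + b) • a j‖ ≤ ε := by
  obtain ⟨b, hb⟩ := exists_forall_iteratedDeriv_tanh_ne_zero (Fintype.card ι * m)
  have hb' : ∀ α : ι → Fin (m + 1), iteratedDeriv (∑ i, (α i : ℕ)) Real.tanh b ≠ 0 := fun α => by
    refine hb _ ?_
    refine (Finset.sum_le_card_nsmul Finset.univ (fun i => (α i : ℕ)) m
      fun i _ => Nat.le_of_lt_succ (α i).2).trans ?_
    simp
  set T : (ι → Fin (m + 1)) → ℝ := fun α => iteratedDeriv (∑ i, (α i : ℕ)) Real.tanh b with hT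
  set S : ℝ := ∑ α, |(T α)⁻¹| * ‖c α‖ with hS
  have hS0 : 0 ≤ S := by positivity
  -- One step `h` serves all of the finitely many `α`, so the neurons are common to all monomials
  -- and only the output coefficients differ.
  have hev : ∀ᶠ h in 𝓝[>] (0 : ℝ), ∀ α : ι → Fin (m + 1), ∀ x : ι → ℝ, (∀ i, |x i| ≤ R) →
      |(∑ j : ι → Fin (m + 1), mixedDiffCoeff α j * h⁻¹ ^ (∑ i, (α i : ℕ)) *
          Real.tanh (b + h * ∑ i, (j i : ℝ) * x i)) - T α * ∏ i, x i ^ (α i : ℕ)|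
        ≤ ε / (S + 1) :=
    eventually_all.2 fun α => eventually_abs_mixedDiff_tanh_sub_le α b R (by positivity)
  obtain ⟨h, hh⟩ := hev.exists
  refine ⟨fun j i => h * j i, b, fun j => ∑ α, ((T α)⁻¹ * (mixedDiffCoeff α j *
    h⁻¹ ^ (∑ i, (α i : ℕ)))) • c α, fun x hx => ?_⟩
  have e1 : ∑ j : ι → Fin (m + 1), Real.tanh ((∑ i, h * (j i : ℝ) * x i) + b) •
      (∑ α, ((T α)⁻¹ * (mixedDiffCoeff α j * h⁻¹ ^ (∑ i, (α i : ℕ)))) • c α) =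
      ∑ α, ((T α)⁻¹ * ∑ j : ι → Fin (m + 1), mixedDiffCoeff α j * h⁻¹ ^ (∑ i, (α i : ℕ)) *
          Real.tanh (b + h * ∑ i, (j i : ℝ) * x i)) • c α := by
    simp_rw [Finset.smul_sum, Finset.mul_sum, Finset.sum_smul]
    rw [Finset.sum_comm]
    refine Finset.sum_congr rfl fun α _ => Finset.sum_congr rfl fun j _ => ?_
    rw [smul_smul]
    congr 1
    rw [add_comm b]
    simp_rw [mul_assoc]
    ring
  rw [e1, ← Finset.sum_sub_distrib]
  calc _ ≤ ∑ α, (|(T α)⁻¹| * ‖c α‖) * (ε / (S + 1)) := by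
        refine (norm_sum_le _ _).trans (Finset.sum_le_sum fun α _ => ?_)
        rw [← sub_smul, norm_smul, Real.norm_eq_abs]
        have h0 : (∏ i, x i ^ (α i : ℕ)) - (T α)⁻¹ * ∑ j : ι → Fin (m + 1), mixedDiffCoeff α j *
            h⁻¹ ^ (∑ i, (α i : ℕ)) * Real.tanh (b + h * ∑ i, (j i : ℝ) * x i) =
            (T α)⁻¹ * -((∑ j : ι → Fin (m + 1), mixedDiffCoeff α j * h⁻¹ ^ (∑ i, (α i : ℕ)) *
              Real.tanh (b + h * ∑ i, (j i : ℝ) * x i)) - T α * ∏ i, x i ^ (α i : ℕ)) := by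
          have := hb' α
          rw [neg_sub, mul_sub, inv_mul_cancel_left₀ this]
        rw [h0, abs_mul, abs_neg, mul_assoc, mul_assoc]
        refine mul_le_mul_of_nonneg_left ?_ (abs_nonneg _)
        rw [mul_comm]
        exact mul_le_mul_of_nonneg_left (hh α x hx) (norm_nonneg _)
    _ = S * (ε / (S + 1)) := by rw [hS, Finset.sum_mul]
    _ ≤ ε := by
        rw [← mul_div_assoc, div_le_iff₀ (by positivity)]
        nlinarith

end Monomials

/-! ### A polynomial kernel that concentrates at the origin -/

open Polynomial in
-- For `N = 4n + 1`, the angle `N (π/2 - φ)` is `π/2 - Nφ` up to a multiple of `2π`.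
theorem eval_chebyshev_T_sin (n : ℕ) (φ : ℝ) :
    (Chebyshev.T ℝ (4 * n + 1 : ℕ)).eval (Real.sin φ) = Real.sin ((4 * n + 1 : ℕ) * φ) := by
  rw [← Real.cos_pi_div_two_sub, Chebyshev.T_real_cos, ← Real.cos_pi_div_two_sub,
    ← Real.cos_sub_nat_mul_two_pi _ n]
  congr 1
  push_cast
  ring

theorem abs_sin_natCast_mul_le (n : ℕ) (φ : ℝ) : |Real.sin (n * φ)| ≤ n * |Real.sin φ| := by
  induction n with
  | zero => simp
  | succ n ih =>
    push_cast
    rw [add_mul, one_mul, Real.sin_add]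
    calc _ ≤ |Real.sin (n * φ)| * |Real.cos φ| + |Real.cos (n * φ)| * |Real.sin φ| := by
          rw [← abs_mul, ← abs_mul]; exact abs_add_le _ _
      _ ≤ |Real.sin (n * φ)| * 1 + 1 * |Real.sin φ| := by
          gcongr
          · exact Real.abs_cos_le_one _
          · exact Real.abs_cos_le_one _
      _ ≤ (n + 1) * |Real.sin φ| := by linarith

/-- The quotient of the Chebyshev polynomial of degree `N = 4n + 1` by the variable has size about
`N` for `|t| ≤ 1 / N`, and decays as `1 / |t|`. -/
theorem exists_polynomial_concentrated (n : ℕ) :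
    ∃ g : Polynomial ℝ, g.natDegree ≤ 4 * n ∧
      (∀ t : ℝ, |t| ≤ 1 → |t| * |g.eval t| ≤ 1) ∧
      (∀ t : ℝ, |t| ≤ 1 → |g.eval t| ≤ (4 * n + 1 : ℕ)) ∧
      (∀ t : ℝ, |t| ≤ 1 / (4 * n + 1 : ℕ) → (4 * n + 1 : ℕ) / 2 ≤ |g.eval t|) := by
  set N : ℕ := 4 * n + 1 with hN
  have hN1 : (1 : ℝ) ≤ N := by exact_mod_cast (by omega : 1 ≤ N)
  obtain ⟨g, hg⟩ : (Polynomial.X : Polynomial ℝ) ∣ Polynomial.Chebyshev.T ℝ N := by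
    rw [Polynomial.X_dvd_iff, Polynomial.coeff_zero_eq_eval_zero]
    have := eval_chebyshev_T_sin n 0
    rw [← hN] at this
    simpa using this
  have hg0 : g ≠ 0 := by
    rintro rfl
    rw [mul_zero] at hg
    exact Polynomial.Chebyshev.T_ne_zero ℝ _ hg
  have hdeg : g.natDegree ≤ 4 * n := by
    have := congrArg Polynomial.natDegree hg
    rw [Polynomial.Chebyshev.natDegree_T, Polynomial.natDegree_X_mul hg0] at this
    simp at this
    omega
  -- All three bounds on `g` come from this identity with `t = sin φ`.
  have key : ∀ φ : ℝ, |Real.sin φ| * |g.eval (Real.sin φ)| = |Real.sin (N * φ)| := fun φ => by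
    rw [← eval_chebyshev_T_sin, ← abs_mul, ← hN, hg]
    simp
  have hne : ∀ t : ℝ, t ≠ 0 → |t| ≤ 1 → |g.eval t| ≤ N := fun t ht ht1 => by
    have h := key (Real.arcsin t)
    have h2 := abs_sin_natCast_mul_le N (Real.arcsin t)
    rw [Real.sin_arcsin (abs_le.1 ht1).1 (abs_le.1 ht1).2] at h h2
    rw [← h, mul_comm] at h2
    exact le_of_mul_le_mul_right h2 (abs_pos.2 ht)
  have hcont : Continuous fun t : ℝ => |g.eval t| := g.continuous.abs
  -- Jordan's inequality applies to `φ` and to `N * φ`: the bound `|t| ≤ 1 / N` forces `|N * φ| ≤ π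
  -- / 2`, and `2 / π ≥ 1 / 2`.
  have hlow : ∀ t : ℝ, t ≠ 0 → |t| ≤ 1 / N → (N : ℝ) / 2 ≤ |g.eval t| := fun t ht htN => by
    have ht1 : |t| ≤ 1 := htN.trans (by rw [div_le_one (by positivity)]; exact hN1)
    have hs := Real.sin_arcsin (abs_le.1 ht1).1 (abs_le.1 ht1).2
    have h := key (Real.arcsin t)
    rw [hs] at h
    set φ := Real.arcsin t with hφ
    have hφ2 : |φ| ≤ Real.pi / 2 := abs_le.2 ⟨Real.neg_pi_div_two_le_arcsin t,
      Real.arcsin_le_pi_div_two t⟩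
    have h1 : 2 / Real.pi * |φ| ≤ |t| := by
      have := Real.mul_abs_le_abs_sin hφ2
      rwa [hs] at this
    have h3 : |t| ≤ |φ| := by
      have := Real.abs_sin_le_abs (x := φ)
      rwa [hs] at this
    have h2 : |N * φ| ≤ Real.pi / 2 := by
      rw [abs_mul, Nat.abs_cast]
      have := h1.trans htN
      rw [div_mul_eq_mul_div, div_le_div_iff₀ Real.pi_pos (by positivity)] at this
      linarith
    have h4 := Real.mul_abs_le_abs_sin h2
    rw [← h, abs_mul, Nat.abs_cast] at h4
    have h5 : |t| * (N / 2) ≤ |t| * |g.eval t| := by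
      refine le_trans ?_ h4
      have : (1 : ℝ) / 2 ≤ 2 / Real.pi := by
        rw [div_le_div_iff₀ (by norm_num) Real.pi_pos]
        linarith [Real.pi_le_four]
      calc |t| * (N / 2) = 1 / 2 * (N * |t|) := by ring
        _ ≤ 2 / Real.pi * (N * |φ|) := by gcongr
    exact le_of_mul_le_mul_left h5 (abs_pos.2 ht)
  -- The identity cannot be divided by `t` at `t = 0`; there the bounds follow by continuity from
  -- nearby nonzero points.
  have hfreq : ∃ᶠ t in nhds (0 : ℝ), t ≠ 0 ∧ |t| ≤ 1 ∧ |t| ≤ 1 / (N : ℝ) := by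
    have h1 : ∃ᶠ t in nhds (0 : ℝ), t ≠ 0 := by
      have : ∃ᶠ t in nhdsWithin (0 : ℝ) {0}ᶜ, True := Filter.frequently_true_iff_neBot _ |>.2 inferInstance
      rw [frequently_nhdsWithin_iff] at this
      exact this.mono fun t ht => ht.2
    have h2 : ∀ δ : ℝ, 0 < δ → ∀ᶠ t in nhds (0 : ℝ), |t| ≤ δ := fun δ hδ => by
      filter_upwards [Metric.ball_mem_nhds (0 : ℝ) hδ] with t ht
      rw [Metric.mem_ball, Real.dist_eq, sub_zero] at ht
      exact ht.le
    refine (h1.and_eventually ((h2 1 one_pos).and (h2 (1 / N) (by positivity)))).mono ?_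
    exact fun t ht => ⟨ht.1, ht.2⟩
  refine ⟨g, hdeg, fun t ht => ?_, fun t ht => ?_, fun t ht => ?_⟩
  · have h := key (Real.arcsin t)
    rw [Real.sin_arcsin (abs_le.1 ht).1 (abs_le.1 ht).2] at h
    rw [h]
    exact Real.abs_sin_le_one _
  · rcases eq_or_ne t 0 with rfl | h0
    · by_contra! hc
      obtain ⟨t, h1, h2⟩ := (hcont.tendsto 0).eventually_const_lt hc
        |>.and_frequently hfreq |>.exists
      obtain ⟨h3, h4, -⟩ := h2
      exact absurd (hne t h3 h4) h1.not_ge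
    · exact hne t h0 ht
  · rcases eq_or_ne t 0 with rfl | h0
    · by_contra! hc
      obtain ⟨t, h1, h2⟩ := (hcont.tendsto 0).eventually_lt_const hc
        |>.and_frequently hfreq |>.exists
      exact absurd (hlow t h2.1 h2.2.2) h1.not_ge
    · exact hlow t h0 ht

theorem integral_inv_one_add_sq_mul_le {N : ℝ} (hN : 0 < N) :
    ∫ t in (-1 : ℝ)..1, (1 + (N * t) ^ 2)⁻¹ ≤ Real.pi / N := by
  rw [intervalIntegral.integral_comp_mul_left (fun t => (1 + t ^ 2)⁻¹) hN.ne',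
    integral_inv_one_add_sq, smul_eq_mul, div_eq_inv_mul]
  refine mul_le_mul_of_nonneg_left ?_ (by positivity)
  linarith [Real.arctan_lt_pi_div_two (N * 1), Real.neg_pi_div_two_lt_arctan (N * -1)]

/-- Nonnegative polynomial kernels of integral one on `[-1, 1]` whose `r`-th absolute moment is of
order `(degree)⁻ʳ`. -/
theorem exists_polynomial_kernel (r : ℕ) :
    ∃ C : ℝ, 0 < C ∧ ∀ n : ℕ, 0 < n → ∃ p : Polynomial ℝ, p.natDegree ≤ 8 * (r + 1) * n ∧
      (∀ t, 0 ≤ p.eval t) ∧ (∫ t in (-1 : ℝ)..1, p.eval t) = 1 ∧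
      (∫ t in (-1 : ℝ)..1, |t| ^ r * p.eval t) ≤ C / (n : ℝ) ^ r := by
  refine ⟨Real.pi * 2 ^ (2 * r + 2), by positivity, fun n hn => ?_⟩
  obtain ⟨g, hdeg, hdecay, hup, hlow⟩ := exists_polynomial_concentrated n
  set N : ℕ := 4 * n + 1 with hN
  have hN1 : (1 : ℝ) ≤ N := by exact_mod_cast (by omega : 1 ≤ N)
  have hN0 : (0 : ℝ) < N := by linarith
  -- The even exponent gives nonnegativity. With `G = |g|`, the moment splits as `(|t| G)^r * G^r *
  -- G^2`, where `G^2` is at most `2N² / (1 + (N t)²)`. The moment is thus of order `N^(r+1)`,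
  -- against a total mass of order at least `N^(2r+1)`.
  set q : Polynomial ℝ := g ^ (2 * r + 2) with hq
  have hqe : ∀ t, q.eval t = |g.eval t| ^ (2 * r + 2) := fun t => by
    rw [hq, Polynomial.eval_pow, Even.pow_abs ⟨r + 1, by ring⟩]
  have hq0 : ∀ t, 0 ≤ q.eval t := fun t => by rw [hqe]; positivity
  set Z := ∫ t in (-1 : ℝ)..1, q.eval t with hZ
  have hint : ∀ a b : ℝ, IntervalIntegrable (fun t => q.eval t) MeasureTheory.volume a b :=
    fun a b => q.continuous.intervalIntegrable a b
  have hZlow : 2 / N * ((N : ℝ) / 2) ^ (2 * r + 2) ≤ Z := by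
    have hNi : (1 : ℝ) / N ≤ 1 := by rw [div_le_one hN0]; exact hN1
    have hNi0 : (0 : ℝ) < 1 / N := by positivity
    calc 2 / N * ((N : ℝ) / 2) ^ (2 * r + 2)
        = ∫ _ in (-(1 / N : ℝ))..(1 / N), ((N : ℝ) / 2) ^ (2 * r + 2) := by
          rw [intervalIntegral.integral_const, smul_eq_mul]; ring
      _ ≤ ∫ t in (-(1 / N : ℝ))..(1 / N), q.eval t := by
          refine intervalIntegral.integral_mono_on (by linarith) (by simp) (hint _ _) fun t ht => ?_
          rw [hqe]
          exact pow_le_pow_left₀ (by positivity) (hlow t (abs_le.2 ht)) _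
      _ ≤ Z := by
          refine intervalIntegral.integral_mono_interval (by linarith) (by linarith) hNi
            (Filter.Eventually.of_forall hq0) (hint _ _)
  have hZ0 : 0 < Z := lt_of_lt_of_le (by positivity) hZlow
  have hmom : ∫ t in (-1 : ℝ)..1, |t| ^ r * q.eval t ≤ 2 * N ^ (r + 2) * (Real.pi / N) := by
    calc _ ≤ ∫ t in (-1 : ℝ)..1, 2 * (N : ℝ) ^ (r + 2) * (1 + (N * t) ^ 2)⁻¹ := by
          refine intervalIntegral.integral_mono_on (by norm_num) ?_ ?_ fun t ht => ?_
          · exact ((continuous_abs.pow r).mul q.continuous).intervalIntegrable _ _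
          · refine Continuous.intervalIntegrable ?_ _ _
            refine continuous_const.mul (Continuous.inv₀ (by fun_prop) fun t => ?_)
            positivity
          · have ht1 : |t| ≤ 1 := abs_le.2 ht
            have h1 := hdecay t ht1
            have h2 := hup t ht1
            set G := |g.eval t| with hG
            have hG0 : 0 ≤ G := abs_nonneg _
            have h3 : G ^ 2 * (1 + (N * t) ^ 2) ≤ 2 * N ^ 2 := by
              have e1 : G ^ 2 ≤ (N : ℝ) ^ 2 := pow_le_pow_left₀ hG0 h2 2
              have e2 : (|t| * G) ^ 2 ≤ 1 := pow_le_one₀ (by positivity) h1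
              rw [mul_pow, sq_abs] at e2
              have : (N : ℝ) ^ 2 * (t ^ 2 * G ^ 2) ≤ N ^ 2 * 1 := by gcongr
              nlinarith
            rw [hqe, ← hG, ← div_eq_mul_inv, le_div_iff₀ (by positivity)]
            calc |t| ^ r * G ^ (2 * r + 2) * (1 + ((N : ℝ) * t) ^ 2)
                = (|t| * G) ^ r * G ^ r * (G ^ 2 * (1 + ((N : ℝ) * t) ^ 2)) := by
                  rw [mul_pow]; ring
              _ ≤ 1 * (N : ℝ) ^ r * (2 * N ^ 2) := by
                  have : (|t| * G) ^ r ≤ 1 := pow_le_one₀ (by positivity) h1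
                  gcongr
              _ = 2 * N ^ (r + 2) := by ring
      _ ≤ 2 * N ^ (r + 2) * (Real.pi / N) := by
          rw [intervalIntegral.integral_const_mul]
          exact mul_le_mul_of_nonneg_left (integral_inv_one_add_sq_mul_le hN0) (by positivity)
  refine ⟨Polynomial.C Z⁻¹ * q, ?_, fun t => ?_, ?_, ?_⟩
  · refine (Polynomial.natDegree_C_mul_le _ _).trans (Polynomial.natDegree_pow_le.trans ?_)
    calc (2 * r + 2) * g.natDegree ≤ (2 * r + 2) * (4 * n) := Nat.mul_le_mul_left _ hdeg
      _ = 8 * (r + 1) * n := by ring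
  · rw [Polynomial.eval_mul, Polynomial.eval_C]
    exact mul_nonneg (inv_nonneg.2 hZ0.le) (hq0 t)
  · simp_rw [Polynomial.eval_mul, Polynomial.eval_C]
    rw [intervalIntegral.integral_const_mul, ← hZ, inv_mul_cancel₀ hZ0.ne']
  · simp_rw [Polynomial.eval_mul, Polynomial.eval_C, mul_left_comm _ Z⁻¹]
    rw [intervalIntegral.integral_const_mul, ← div_eq_inv_mul, div_le_div_iff₀ hZ0 (by positivity)]
    have hnN : (n : ℝ) ^ r ≤ (N : ℝ) ^ r :=
      pow_le_pow_left₀ (by positivity) (by exact_mod_cast (by omega : n ≤ N)) r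
    calc _ ≤ 2 * (N : ℝ) ^ (r + 2) * (Real.pi / N) * N ^ r := by
          gcongr
      _ = Real.pi * 2 ^ (2 * r + 2) * (2 / N * ((N : ℝ) / 2) ^ (2 * r + 2)) := by
          rw [div_pow]
          field_simp
          ring
      _ ≤ _ := mul_le_mul_of_nonneg_left hZlow (by positivity)

/-! ### Polynomial approximation of smooth functions with values in a Banach space -/

/-- By induction on the order: the mean value inequality bounds the `r`-th derivative of `fwdDiff t
f` by `M * ‖t‖`. -/
theorem norm_fwdDiff_iter_le {E F : Type*} [NormedAddCommGroup E] [NormedSpace ℝ E]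
    [NormedAddCommGroup F] [NormedSpace ℝ F] (t : E) (r : ℕ) {M : ℝ} {f : E → F}
    (hf : ContDiff ℝ r f) (hM : ∀ x, ‖iteratedFDeriv ℝ r f x‖ ≤ M) (x : E) :
    ‖(fwdDiff t)^[r] f x‖ ≤ M * ‖t‖ ^ r := by
  induction r generalizing f M x with
  | zero => simpa using hM x
  | succ r ih =>
    rw [Function.iterate_succ_apply, pow_succ', ← mul_assoc]
    have hfr : ContDiff ℝ r f := hf.of_le (by exact_mod_cast Nat.le_succ r)
    have hsh : ContDiff ℝ r fun y => f (y + t) := hfr.comp (contDiff_id.add contDiff_const)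
    refine ih (f := fwdDiff t f) (hsh.sub hfr) (fun y => ?_) x
    have e : iteratedFDeriv ℝ r (fwdDiff t f) y =
        iteratedFDeriv ℝ r f (y + t) - iteratedFDeriv ℝ r f y := by
      rw [← iteratedFDeriv_comp_add_right]
      exact iteratedFDeriv_sub_apply hsh.contDiffAt hfr.contDiffAt
    rw [e]
    have := Convex.norm_image_sub_le_of_norm_fderiv_le (𝕜 := ℝ) (f := iteratedFDeriv ℝ r f)
      (s := Set.univ) (x := y) (y := y + t) (C := M)
      (fun z _ => (hf.differentiable_iteratedFDeriv (by exact_mod_cast Nat.lt_succ_self r)) z)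
      (fun z _ => by rw [norm_fderiv_iteratedFDeriv]; exact hM z) convex_univ trivial trivial
    simpa using this

theorem pi_norm_pow_le_sum {ι : Type*} [Fintype ι] [Nonempty ι] (t : ι → ℝ) (r : ℕ) :
    ‖t‖ ^ r ≤ ∑ i, |t i| ^ r := by
  obtain ⟨i, hi⟩ : ∃ i, ‖t‖ ≤ |t i| := by
    by_contra! hc
    have h0 : 0 < ‖t‖ := (abs_nonneg _).trans_lt (hc (Classical.arbitrary ι))
    exact lt_irrefl _ ((pi_norm_lt_iff h0).2 hc)
  exact (pow_le_pow_left₀ (norm_nonneg _) hi r).trans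
    (Finset.single_le_sum (f := fun i => |t i| ^ r) (fun i _ => by positivity) (Finset.mem_univ i))

/-! ### Averages against truncated product kernels -/

open MeasureTheory

/-- The restriction of a polynomial to `[-1, 1]`, extended by zero. -/
noncomputable def cutKernel (p : Polynomial ℝ) : ℝ → ℝ :=
  (Set.Icc (-1 : ℝ) 1).indicator fun t => p.eval t

theorem cutKernel_of_abs_le (p : Polynomial ℝ) {t : ℝ} (ht : |t| ≤ 1) :
    cutKernel p t = p.eval t :=
  Set.indicator_of_mem (s := Set.Icc (-1 : ℝ) 1) (abs_le.1 ht) _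

theorem integral_mul_cutKernel (p : Polynomial ℝ) (φ : ℝ → ℝ) :
    ∫ t, φ t * cutKernel p t = ∫ t in (-1 : ℝ)..1, φ t * p.eval t := by
  have : (fun t => φ t * cutKernel p t) =
      (Set.Icc (-1 : ℝ) 1).indicator fun t => φ t * p.eval t := by
    funext t
    rw [cutKernel, Set.indicator_mul_right]
  rw [this, integral_indicator measurableSet_Icc, integral_Icc_eq_integral_Ioc,
    intervalIntegral.integral_of_le (by norm_num)]

theorem integrable_mul_cutKernel (p : Polynomial ℝ) {φ : ℝ → ℝ} (hφ : Continuous φ) :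
    Integrable fun t => φ t * cutKernel p t := by
  have : (fun t => φ t * cutKernel p t) =
      (Set.Icc (-1 : ℝ) 1).indicator fun t => φ t * p.eval t := by
    funext t
    rw [cutKernel, Set.indicator_mul_right]
  rw [this, integrable_indicator_iff measurableSet_Icc]
  exact (hφ.mul p.continuous).continuousOn.integrableOn_Icc

theorem cutKernel_nonneg {p : Polynomial ℝ} (hp : ∀ t, 0 ≤ p.eval t) (t : ℝ) :
    0 ≤ cutKernel p t :=
  Set.indicator_nonneg (fun t _ => hp t) t

section Jackson

variable {ι : Type*} [Fintype ι]

theorem integrable_prod_cutKernel (p : Polynomial ℝ) :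
    Integrable fun t : ι → ℝ => ∏ i, cutKernel p (t i) := by
  refine Integrable.fintype_prod (f := fun _ : ι => cutKernel p) (μ := fun _ => volume) fun i => ?_
  simpa using integrable_mul_cutKernel p (φ := fun _ => 1) continuous_const

theorem integral_prod_cutKernel {p : Polynomial ℝ} (hp1 : ∫ t in (-1 : ℝ)..1, p.eval t = 1) :
    ∫ t : ι → ℝ, ∏ i, cutKernel p (t i) = 1 := by
  rw [integral_fintype_prod_volume_eq_prod (fun _ : ι => cutKernel p)]
  have := integral_mul_cutKernel p (fun _ => 1)
  simp only [one_mul] at this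
  rw [this, hp1, Finset.prod_const_one]

theorem abs_pow_mul_prod_cutKernel [DecidableEq ι] (p : Polynomial ℝ) (r : ℕ) (i : ι) (t : ι → ℝ) :
    |t i| ^ r * ∏ j, cutKernel p (t j) =
      ∏ j, (if j = i then |t j| ^ r else 1) * cutKernel p (t j) := by
  rw [Finset.prod_mul_distrib]
  simp

theorem integrable_abs_pow_mul_prod_cutKernel (p : Polynomial ℝ) (r : ℕ) (i : ι) :
    Integrable fun t : ι → ℝ => |t i| ^ r * ∏ j, cutKernel p (t j) := by
  classical
  simp_rw [abs_pow_mul_prod_cutKernel]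
  refine Integrable.fintype_prod (f := fun j s => (if j = i then |s| ^ r else 1) * cutKernel p s)
    (μ := fun _ => volume) fun j => integrable_mul_cutKernel p ?_
  split_ifs <;> fun_prop

theorem integral_abs_pow_mul_prod_cutKernel {p : Polynomial ℝ}
    (hp1 : ∫ t in (-1 : ℝ)..1, p.eval t = 1) (r : ℕ) (i : ι) :
    ∫ t : ι → ℝ, |t i| ^ r * ∏ j, cutKernel p (t j) = ∫ t in (-1 : ℝ)..1, |t| ^ r * p.eval t := by
  classical
  simp_rw [abs_pow_mul_prod_cutKernel]
  rw [integral_fintype_prod_volume_eq_prod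
    (fun j s => (if j = i then |s| ^ r else 1) * cutKernel p s)]
  simp_rw [integral_mul_cutKernel]
  rw [Finset.prod_eq_single i (fun j _ hj => by simpa [hj] using hp1) (by simp)]
  simp

variable {F : Type*} [NormedAddCommGroup F] [NormedSpace ℝ F]

/-- This separates the variables of a convolution kernel, so that the integral over `u` leaves a
polynomial in `v`. -/
theorem eval_sub_eq_sum {p : Polynomial ℝ} {m : ℕ} (hm : p.natDegree ≤ m) (u v : ℝ) :
    p.eval (u - v) = ∑ j : Fin (m + 1), (Polynomial.hasseDeriv j p).eval u * (-v) ^ (j : ℕ) := by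
  have h := Polynomial.taylor_eval u p (-v)
  rw [Polynomial.eval_eq_sum_range' (n := m + 1)
    (by rw [Polynomial.natDegree_taylor]; omega)] at h
  simp_rw [Polynomial.taylor_coeff] at h
  rw [show u - v = -v + u by ring, ← h,
    Fin.sum_univ_eq_sum_range fun j => (Polynomial.hasseDeriv j p).eval u * (-v) ^ j]

/-- Averages of `f` against a truncated polynomial kernel are polynomials, on the cube that carries
the support of `f`. -/
theorem exists_integral_cutKernel_eq_sum [DecidableEq ι] {f : (ι → ℝ) → F} (hf : Continuous f)
    {R : ℝ} (hsupp : ∀ s, f s ≠ 0 → ∀ i, |s i| ≤ R) {p : Polynomial ℝ} {m : ℕ}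
    (hm : p.natDegree ≤ m) {a : ℝ} (ha : 0 < a) (haR : 2 * R ≤ a) :
    ∃ c : (ι → Fin (m + 1)) → F, ∀ x : ι → ℝ, (∀ i, |x i| ≤ R) →
      ∫ t : ι → ℝ, (∏ i, cutKernel p (t i)) • f (x + a • t) =
        ∑ α, (∏ i, x i ^ (α i : ℕ)) • c α := by
  have hcs : HasCompactSupport f := by
    refine HasCompactSupport.intro (isCompact_univ_pi fun _ : ι => isCompact_Icc (a := -R) (b := R))
      fun s hs => ?_
    by_contra h0
    exact hs fun i _ => abs_le.1 (hsupp s h0 i)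
  refine ⟨fun α => (∏ i : ι, (-a⁻¹) ^ (α i : ℕ)) • |(a ^ Module.finrank ℝ (ι → ℝ))⁻¹| •
    ∫ s : ι → ℝ, (∏ i, (Polynomial.hasseDeriv (α i) p).eval (a⁻¹ * s i)) • f s, fun x hx => ?_⟩
  set h : (ι → ℝ) → F := fun s => (∏ i, p.eval (a⁻¹ * (s i - x i))) • f s with hh
  -- Where `f` does not vanish, both `x` and `x + a • t` lie in the cube, so `|a * t i| ≤ 2 * R ≤ a`
  -- and the truncation is not felt.
  have h1 : ∀ t : ι → ℝ, (∏ i, cutKernel p (t i)) • f (x + a • t) = h (x + a • t) := by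
    intro t
    by_cases h0 : f (x + a • t) = 0
    · simp [hh, h0]
    · rw [hh]
      simp only [Pi.add_apply, Pi.smul_apply, smul_eq_mul, add_sub_cancel_left,
        inv_mul_cancel_left₀ ha.ne']
      congr 1
      refine Finset.prod_congr rfl fun i _ => cutKernel_of_abs_le p ?_
      have e1 := hsupp _ h0 i
      simp only [Pi.add_apply, Pi.smul_apply, smul_eq_mul] at e1
      have e2 := hx i
      have e3 : |a * t i| ≤ a := by
        have := abs_sub (x i + a * t i) (x i)
        rw [add_sub_cancel_left] at this
        linarith
      rw [abs_mul, abs_of_pos ha] at e3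
      exact le_of_mul_le_mul_left (by linarith) ha
  simp_rw [h1]
  -- The substitution `s = x + a • t` moves the dependence on `x` from `f` to the polynomial.
  rw [Measure.integral_comp_smul volume (fun t => h (x + t)) a, integral_add_left_eq_self h x]
  have h2 : ∀ s, h s = ∑ α : ι → Fin (m + 1), ((∏ i, x i ^ (α i : ℕ)) *
      ∏ i : ι, (-a⁻¹) ^ (α i : ℕ)) •
        ((∏ i, (Polynomial.hasseDeriv (α i) p).eval (a⁻¹ * s i)) • f s) := by
    intro s
    simp only [hh, mul_sub]
    simp_rw [eval_sub_eq_sum hm]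
    rw [Finset.prod_univ_sum, Fintype.piFinset_univ, Finset.sum_smul]
    refine Finset.sum_congr rfl fun α _ => ?_
    rw [smul_smul]
    congr 1
    rw [← Finset.prod_mul_distrib, ← Finset.prod_mul_distrib]
    refine Finset.prod_congr rfl fun i _ => ?_
    rw [← mul_pow]
    ring
  simp_rw [h2]
  rw [integral_finsetSum, Finset.smul_sum]
  · refine Finset.sum_congr rfl fun α _ => ?_
    rw [integral_smul, mul_smul, smul_comm |_|, smul_comm |_|]
  · intro α _
    refine Integrable.smul _ (Continuous.integrable_of_hasCompactSupport ?_ hcs.smul_left)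
    refine Continuous.smul (continuous_finsetProd _ fun i _ => ?_) hf
    exact (Polynomial.continuous _).comp (continuous_const.mul (continuous_apply i))

/-- **Jackson's theorem** on a cube, for functions of compact support with values in a Banach space,
in terms of a kernel. -/
theorem exists_polynomial_approx_of_kernel [DecidableEq ι] [Nonempty ι] [CompleteSpace F]
    {f : (ι → ℝ) → F} (hf : Continuous f) {R : ℝ} (hR : 0 < R)
    (hsupp : ∀ s, f s ≠ 0 → ∀ i, |s i| ≤ R) {r : ℕ} {M : ℝ} (hM0 : 0 ≤ M)
    (hdiff : ∀ x t, ‖(fwdDiff t)^[r] f x‖ ≤ M * ‖t‖ ^ r) {p : Polynomial ℝ} {m : ℕ}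
    (hm : p.natDegree ≤ m) (hp0 : ∀ t, 0 ≤ p.eval t) (hp1 : ∫ t in (-1 : ℝ)..1, p.eval t = 1) :
    ∃ c : (ι → Fin (m + 1)) → F, ∀ x : ι → ℝ, (∀ i, |x i| ≤ R) →
      ‖f x - ∑ α, (∏ i, x i ^ (α i : ℕ)) • c α‖ ≤
        M * (2 * R) ^ r * (Fintype.card ι * ∫ t in (-1 : ℝ)..1, |t| ^ r * p.eval t) := by
  have hcs : HasCompactSupport f := by
    refine HasCompactSupport.intro (isCompact_univ_pi fun _ : ι => isCompact_Icc (a := -R) (b := R))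
      fun s hs => ?_
    by_contra h0
    exact hs fun i _ => abs_le.1 (hsupp s h0 i)
  obtain ⟨B, hB⟩ := hcs.exists_bound_of_continuous hf
  set G : (ι → ℝ) → ℝ := fun t => ∏ i, cutKernel p (t i) with hG
  have hGint : Integrable G := integrable_prod_cutKernel p
  have hG0 : ∀ t, 0 ≤ G t := fun t => Finset.prod_nonneg fun i _ => cutKernel_nonneg hp0 _
  have hint : ∀ (x : ι → ℝ) (b : ℝ), Integrable fun t => G t • f (x + b • t) := fun x b =>
    hGint.smul_bdd B (f := fun t => f (x + b • t))
      (hf.comp (by fun_prop)).aestronglyMeasurable (Filter.Eventually.of_forall fun t => hB _)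
  have hex : ∀ k : ℕ, ∃ c : (ι → Fin (m + 1)) → F, ∀ x : ι → ℝ, (∀ i, |x i| ≤ R) →
      ∫ t : ι → ℝ, G t • f (x + (2 * R * (k + 1 : ℕ)) • t) = ∑ α, (∏ i, x i ^ (α i : ℕ)) • c α :=
    fun k => exists_integral_cutKernel_eq_sum hf hsupp hm (by positivity) (by
      push_cast; nlinarith [Nat.cast_nonneg (α := ℝ) k])
  choose c hc using hex
  set w : ℕ → ℝ := fun k => (-1) ^ (r - k) * r.choose k with hw
  refine ⟨fun α => -((-1 : ℝ) ^ r • ∑ k ∈ Finset.range r, w (k + 1) • c k α), fun x hx => ?_⟩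
  -- In the `r`-th difference with step `2 * R • t`, the zeroth term is `± f x` and the others
  -- average to polynomials in `x`. The averaged difference is therefore the approximation error up
  -- to sign.
  have hD : ∀ t : ι → ℝ, (fwdDiff ((2 * R) • t))^[r] f x =
      (∑ k ∈ Finset.range r, w (k + 1) • f (x + (2 * R * (k + 1 : ℕ)) • t)) + w 0 • f x := by
    intro t
    rw [fwdDiff_iter_eq_sum_shift, Finset.sum_range_succ']
    congr 1
    · refine Finset.sum_congr rfl fun k _ => ?_
      rw [← Int.cast_smul_eq_zsmul ℝ, ← Nat.cast_smul_eq_nsmul ℝ (k + 1), smul_smul, mul_comm _ (2 * R)]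
      simp [hw]
    · rw [← Int.cast_smul_eq_zsmul ℝ]
      simp [hw]
  have hI : ∫ t, G t • (fwdDiff ((2 * R) • t))^[r] f x =
      (∑ k ∈ Finset.range r, w (k + 1) • ∑ α, (∏ i, x i ^ (α i : ℕ)) • c k α) + w 0 • f x := by
    simp_rw [hD, smul_add, Finset.smul_sum, smul_comm (G _) (w _)]
    rw [integral_add, integral_finsetSum]
    · congr 1
      · refine Finset.sum_congr rfl fun k _ => ?_
        rw [integral_smul, hc k x hx]
        exact Finset.smul_sum
      · rw [integral_smul, integral_smul_const, integral_prod_cutKernel hp1, one_smul]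
    · exact fun k _ => (hint x _).smul _
    · exact integrable_finsetSum _ fun k _ => (hint x _).smul _
    · exact (hGint.smul_const _).smul _
  have hw0 : (-1 : ℝ) ^ r * w 0 = 1 := by
    simp only [hw, Nat.sub_zero, Nat.choose_zero_right, Nat.cast_one, mul_one, ← mul_pow]
    norm_num
  have hfx : f x - ∑ α, (∏ i, x i ^ (α i : ℕ)) •
      (-((-1 : ℝ) ^ r • ∑ k ∈ Finset.range r, w (k + 1) • c k α)) =
      (-1 : ℝ) ^ r • ∫ t, G t • (fwdDiff ((2 * R) • t))^[r] f x := by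
    rw [hI, smul_add, smul_smul, hw0, one_smul, add_comm _ (f x), sub_eq_add_neg]
    congr 1
    simp_rw [smul_neg, Finset.sum_neg_distrib, neg_neg, Finset.smul_sum]
    rw [Finset.sum_comm]
    refine Finset.sum_congr rfl fun k _ => Finset.sum_congr rfl fun α _ => ?_
    simp only [smul_smul]
    congr 1
    ring
  rw [hfx, norm_smul, norm_pow, norm_neg, norm_one, one_pow, one_mul]
  have hbound : Integrable fun t : ι → ℝ => M * (2 * R) ^ r * ∑ i, |t i| ^ r * G t :=
    (integrable_finsetSum _ fun i _ => integrable_abs_pow_mul_prod_cutKernel p r i).const_mul _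
  refine (norm_integral_le_of_norm_le hbound (Filter.Eventually.of_forall fun t => ?_)).trans_eq ?_
  · rw [norm_smul, Real.norm_of_nonneg (hG0 t), ← Finset.sum_mul]
    have h1 := hdiff x ((2 * R) • t)
    rw [norm_smul, Real.norm_of_nonneg (by positivity : 0 ≤ 2 * R), mul_pow] at h1
    calc _ ≤ G t * (M * ((2 * R) ^ r * ‖t‖ ^ r)) := mul_le_mul_of_nonneg_left h1 (hG0 t)
      _ ≤ G t * (M * ((2 * R) ^ r * ∑ i, |t i| ^ r)) := by
          have := hG0 t
          have := pi_norm_pow_le_sum t r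
          gcongr
      _ = _ := by ring
  · rw [integral_const_mul, integral_finsetSum _ fun i _ =>
      integrable_abs_pow_mul_prod_cutKernel p r i]
    simp_rw [integral_abs_pow_mul_prod_cutKernel hp1]
    simp

end Jackson

/-! ### Cutoff functions -/

theorem exists_contDiff_cutoff {E : Type*} [NormedAddCommGroup E] [NormedSpace ℝ E]
    [FiniteDimensional ℝ E] {K Ω : Set E} (hK : IsCompact K) (hΩ : IsOpen Ω) (hKΩ : K ⊆ Ω) (r : ℕ) :
    ∃ χ : E → ℝ, ContDiff ℝ r χ ∧ HasCompactSupport χ ∧ tsupport χ ⊆ Ω ∧ (∀ x ∈ K, χ x = 1) ∧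
      ∃ B : ℝ, 0 ≤ B ∧ ∀ i ≤ r, ∀ x, ‖iteratedFDeriv ℝ i χ x‖ ≤ B := by
  obtain ⟨L, hL, hKL, hLΩ⟩ := exists_compact_between hK hΩ hKΩ
  obtain ⟨χ, h1, h0, -⟩ := exists_contMDiffMap_one_nhds_of_subset_interior
    (modelWithCornersSelf ℝ E) (n := (r : ℕ∞)) hK.isClosed hKL
  have hcs : HasCompactSupport χ := HasCompactSupport.intro hL h0
  have hχ : ContDiff ℝ r χ := χ.contMDiff.contDiff
  have hbd : ∀ i : ℕ, ∃ B : ℝ, i ≤ r → ∀ x, ‖iteratedFDeriv ℝ i χ x‖ ≤ B := by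
    intro i
    by_cases hi : i ≤ r
    · obtain ⟨B, hB⟩ := (hcs.iteratedFDeriv (𝕜 := ℝ) i).exists_bound_of_continuous
        (hχ.continuous_iteratedFDeriv (by exact_mod_cast hi))
      exact ⟨B, fun _ => hB⟩
    · exact ⟨0, fun h => absurd h hi⟩
  choose B hB using hbd
  refine ⟨χ, hχ, hcs, ?_, fun x hx => h1.self_of_nhdsSet x hx,
    ∑ i ∈ Finset.range (r + 1), |B i|, by positivity, fun i hi x => ?_⟩
  · refine (closure_minimal (fun x hx => ?_) hL.isClosed).trans hLΩ
    by_contra hxL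
    exact hx (h0 x hxL)
  · exact ((hB i hi x).trans (le_abs_self _)).trans (Finset.single_le_sum (f := fun i => |B i|)
      (fun i _ => abs_nonneg _) (Finset.mem_range.2 (Nat.lt_succ_of_le hi)))

section CutoffSMul

variable {E F : Type*} [NormedAddCommGroup E] [NormedSpace ℝ E] [NormedAddCommGroup F]
  [NormedSpace ℝ F] {Ω : Set E} {r : ℕ} {χ : E → ℝ} {g : E → F}

/-- Smoothness needs checking only on the support of the product, which lies in `Ω`; the values of
`g` outside `Ω` do not matter. -/
theorem contDiff_cutoff_smul (hΩ : IsOpen Ω) (hχ : ContDiff ℝ r χ) (hsupp : tsupport χ ⊆ Ω)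
    (hg : ContDiffOn ℝ r g Ω) : ContDiff ℝ r fun x => χ x • g x := by
  refine contMDiff_iff_contDiff.1 (contMDiff_of_tsupport fun x hx => ?_)
  have hxΩ : x ∈ Ω := hsupp (tsupport_smul_subset_left χ g hx)
  exact (hχ.contDiffAt.smul (hg.contDiffAt (hΩ.mem_nhds hxΩ))).contMDiffAt

theorem norm_iteratedFDeriv_cutoff_smul_le (hΩ : IsOpen Ω) (hχ : ContDiff ℝ r χ)
    (hsupp : tsupport χ ⊆ Ω) (hg : ContDiffOn ℝ r g Ω) {B S : ℝ} (hB0 : 0 ≤ B) (hS0 : 0 ≤ S)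
    (hB : ∀ i ≤ r, ∀ x, ‖iteratedFDeriv ℝ i χ x‖ ≤ B)
    (hS : ∀ i ≤ r, ∀ x ∈ Ω, ‖iteratedFDeriv ℝ i g x‖ ≤ S) (x : E) :
    ‖iteratedFDeriv ℝ r (fun x => χ x • g x) x‖ ≤ 2 ^ r * B * S := by
  by_cases hx : x ∈ Ω
  · have h := norm_iteratedFDerivWithin_smul_le (n := r) hχ.contDiffOn hg hΩ.uniqueDiffOn hx le_rfl
    rw [iteratedFDerivWithin_of_isOpen r hΩ hx] at h
    refine h.trans ?_
    calc _ ≤ ∑ i ∈ Finset.range (r + 1), (r.choose i : ℝ) * (B * S) := by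
          refine Finset.sum_le_sum fun i hi => ?_
          have hi' : i ≤ r := Nat.le_of_lt_succ (Finset.mem_range.1 hi)
          rw [iteratedFDerivWithin_of_isOpen i hΩ hx, iteratedFDerivWithin_of_isOpen (r - i) hΩ hx,
            mul_assoc]
          have h1 := hB i hi' x
          have h2 := hS (r - i) (Nat.sub_le r i) x hx
          gcongr
      _ = 2 ^ r * B * S := by
          rw [← Finset.sum_mul, ← Nat.cast_sum, Nat.sum_range_choose]
          push_cast
          ring
  · have h0 : x ∉ tsupport fun x => χ x • g x := fun h =>
      hx (hsupp (tsupport_smul_subset_left χ g h))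
    have : iteratedFDeriv ℝ r (fun x => χ x • g x) x = 0 := by
      by_contra hne
      exact h0 (support_iteratedFDeriv_subset r hne)
    rw [this, norm_zero]
    positivity

theorem norm_iteratedFDeriv_le_smoothnessNorm (hfin : smoothnessNorm r Ω g < ⊤) {i : ℕ}
    (hi : i ≤ r) {x : E} (hx : x ∈ Ω) :
    ‖iteratedFDeriv ℝ i g x‖ ≤ (smoothnessNorm r Ω g).toReal := by
  rw [← toReal_enorm]
  refine ENNReal.toReal_mono hfin.ne ?_
  calc ‖iteratedFDeriv ℝ i g x‖ₑ ≤ ⨆ y ∈ Ω, ‖iteratedFDeriv ℝ i g y‖ₑ :=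
        le_iSup₂ (f := fun y (_ : y ∈ Ω) => ‖iteratedFDeriv ℝ i g y‖ₑ) x hx
    _ ≤ smoothnessNorm r Ω g :=
        Finset.single_le_sum (f := fun k => ⨆ y ∈ Ω, ‖iteratedFDeriv ℝ k g y‖ₑ)
          (fun _ _ => zero_le) (Finset.mem_range.2 (Nat.lt_succ_of_le hi))

end CutoffSMul

/-! ### Networks -/

theorem exists_denseNetwork_const (I D : ℕ) (v : PiLp 1 (fun _ : Fin D => ℝ)) :
    ∃ f : DenseNetwork I D, ∀ y, f.eval y = v :=
  ⟨⟨0, 0, 0, WithLp.ofLp v⟩, fun y => by simp [DenseNetwork.eval]⟩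

/-- The vectors `a j` become columns of the output matrix; surplus neurons get a zero column. -/
theorem exists_denseNetwork_eval_eq_sum {J : Type*} [Fintype J] {I D : ℕ}
    (hJ : Fintype.card J ≤ D) (w : J → Fin I → ℝ) (b : ℝ) (a : J → PiLp 1 (fun _ : Fin D => ℝ)) :
    ∃ f : DenseNetwork I D, ∀ y : EuclideanSpace ℝ (Fin I),
      f.eval y = ∑ j, Real.tanh ((∑ i, w j i * y i) + b) • a j := by
  obtain ⟨e⟩ : Nonempty (J ↪ Fin D) := Function.Embedding.nonempty_of_card_le (by simpa using hJ)
  refine ⟨⟨Matrix.of (Function.extend e w 0), fun _ => b,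
    Matrix.of fun d => Function.extend e (fun j => a j d) 0, 0⟩, fun y => ?_⟩
  ext d
  rw [WithLp.ofLp_sum, Finset.sum_apply]
  change (∑ k, Function.extend e (fun j => a j d) 0 k *
    Real.tanh ((∑ i, Function.extend e w 0 k i * y i) + b)) + 0 =
      ∑ j, Real.tanh ((∑ i, w j i * y i) + b) * a j d
  rw [add_zero]
  symm
  refine Fintype.sum_of_injective e e.injective _ _ (fun k hk => ?_) fun j => ?_
  · rw [Function.extend_apply' _ _ _ (by simpa using hk), Pi.zero_apply, zero_mul]
  · rw [e.injective.extend_apply, e.injective.extend_apply, mul_comm]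

/-- The largest `n` such that `(N n + 1)^I` neurons are available among `D` is of order `D^(1/I)`. -/
theorem exists_pow_le_and_sqrt_le {I r N D : ℕ} (hI : 0 < I) (hN : 0 < N) (hIr : I ≤ 2 * r)
    (hD : (N + 1) ^ I ≤ D) :
    ∃ n : ℕ, 0 < n ∧ (N * n + 1) ^ I ≤ D ∧ Real.sqrt D ≤ (2 * N + 1) ^ I * (n : ℝ) ^ r := by
  set P : ℕ → Prop := fun n => (N * n + 1) ^ I ≤ D with hP
  have hle : ∀ n, P n → n ≤ D := fun n hn => by
    refine le_trans ?_ hn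
    calc n ≤ N * n + 1 := by nlinarith
      _ ≤ (N * n + 1) ^ I := Nat.le_self_pow hI.ne' _
  classical
  have h1 : P 1 := by simpa [hP] using hD
  set n := Nat.findGreatest P D with hn
  have hn1 : 1 ≤ n := Nat.le_findGreatest (hle 1 h1) h1
  have hPn : P n := Nat.findGreatest_spec (hle 1 h1) h1
  have hnot : ¬ P (n + 1) := fun h => by
    have := Nat.le_findGreatest (hle _ h) h
    omega
  refine ⟨n, hn1, hPn, ?_⟩
  -- By maximality `D < (N * (n + 1) + 1) ^ I`, and `1 ≤ n` absorbs the constants.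
  have h2 : D ≤ ((2 * N + 1) * n) ^ I := by
    refine (not_le.1 hnot).le.trans (Nat.pow_le_pow_left ?_ I)
    nlinarith
  rw [Real.sqrt_le_left (by positivity)]
  have h3 : (D : ℝ) ≤ ((2 * N + 1) * n) ^ I := by exact_mod_cast h2
  have hn1' : (1 : ℝ) ≤ n := by exact_mod_cast hn1
  have hN1 : (1 : ℝ) ≤ (2 * N + 1) ^ I := one_le_pow₀ (by linarith [Nat.cast_nonneg (α := ℝ) N])
  calc (D : ℝ) ≤ (2 * N + 1) ^ I * (n : ℝ) ^ I := by rwa [← mul_pow]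
    _ ≤ ((2 * N + 1) ^ I * (2 * N + 1) ^ I) * (n : ℝ) ^ (2 * r) := by
        gcongr
        exact le_mul_of_one_le_left (by positivity) hN1
    _ = _ := by ring

/-- Uniform approximation on a compact set of vector-valued `C^r` functions on an open set, by
networks that have `D` neurons, at the rate `D^(-1/2)`. -/
theorem exists_denseNetwork_approx {I r : ℕ} (hI : 0 < I) (hIr : I ≤ 2 * r)
    {K Ω : Set (EuclideanSpace ℝ (Fin I))} (hK : IsCompact K) (hΩ : IsOpen Ω) (hKΩ : K ⊆ Ω) :
    ∃ c : ℝ, 0 < c ∧ ∀ (D : ℕ), 0 < D →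
      ∀ g : EuclideanSpace ℝ (Fin I) → PiLp 1 (fun _ : Fin D => ℝ),
        ContDiffOn ℝ r g Ω → smoothnessNorm r Ω g < ⊤ →
        ∃ f : DenseNetwork I D, ∀ y ∈ K,
          ‖g y - f.eval y‖ ≤ c * (smoothnessNorm r Ω g).toReal / Real.sqrt D := by
  have : Nonempty (Fin I) := ⟨⟨0, hI⟩⟩
  obtain ⟨χ, hχ, hcs, hχΩ, hχK, B, hB0, hB⟩ := exists_contDiff_cutoff hK hΩ hKΩ r
  obtain ⟨C, hC0, hker⟩ := exists_polynomial_kernel r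
  obtain ⟨R, hR0, hR⟩ : ∃ R : ℝ, 0 < R ∧ ∀ x ∈ tsupport χ, ∀ i, |x i| ≤ R := by
    obtain ⟨R, hR0, hR⟩ := hcs.isCompact.isBounded.exists_pos_norm_le
    exact ⟨R, hR0, fun x hx i => (PiLp.norm_apply_le x i).trans (hR x hx)⟩
  -- The kernel argument uses the sup norm on the cube; `A` is the cost of passing to the Euclidean
  -- norm.
  set T := (PiLp.continuousLinearEquiv 2 ℝ fun _ : Fin I => ℝ).symm with hT
  set A : ℝ := ‖(T : (Fin I → ℝ) →L[ℝ] EuclideanSpace ℝ (Fin I))‖ with hA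
  have hTA : ∀ t, ‖T t‖ ≤ A * ‖t‖ := fun t =>
    (T : (Fin I → ℝ) →L[ℝ] EuclideanSpace ℝ (Fin I)).le_opNorm t
  set N : ℕ := 8 * (r + 1) with hN
  set C₁ : ℝ := 2 ^ r * B * A ^ r * (2 * R) ^ r * (I * C) with hC₁
  have hC₁0 : 0 ≤ C₁ := by positivity
  refine ⟨(C₁ + 1) * (2 * N + 1) ^ I, by positivity, fun D hD g hg hfin => ?_⟩
  set S := (smoothnessNorm r Ω g).toReal with hS
  have hS0 : 0 ≤ S := ENNReal.toReal_nonneg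
  have hSg : ∀ i ≤ r, ∀ x ∈ Ω, ‖iteratedFDeriv ℝ i g x‖ ≤ S := fun i hi x hx =>
    norm_iteratedFDeriv_le_smoothnessNorm hfin hi hx
  have hgS : ∀ y ∈ K, ‖g y‖ ≤ S := fun y hy => by
    simpa using hSg 0 (Nat.zero_le r) y (hKΩ hy)
  have hsq : 0 < Real.sqrt D := Real.sqrt_pos.2 (by exact_mod_cast hD)
  have hN1 : (1 : ℝ) ≤ (2 * N + 1) ^ I := one_le_pow₀ (by linarith [Nat.cast_nonneg (α := ℝ) N])
  -- With too few neurons for degree `N`, the constant absorbs `√D` and the zero network suffices.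
  -- The case `S = 0` is split off because the tolerance `S / n ^ r` below must be positive.
  by_cases hsmall : D < (N + 1) ^ I ∨ S = 0
  · obtain ⟨f, hf⟩ := exists_denseNetwork_const I D 0
    refine ⟨f, fun y hy => ?_⟩
    rw [hf, sub_zero, le_div_iff₀ hsq]
    rcases hsmall with hsmall | hS'
    · have h1 : Real.sqrt D ≤ (2 * N + 1) ^ I := by
        rw [Real.sqrt_le_left (by positivity)]
        have h2 : (D : ℝ) ≤ (N + 1) ^ I := by exact_mod_cast hsmall.le
        have h3 : ((N : ℝ) + 1) ^ I ≤ (2 * N + 1) ^ I := by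
          gcongr
          linarith [Nat.cast_nonneg (α := ℝ) N]
        nlinarith
      calc ‖g y‖ * Real.sqrt D ≤ S * (2 * N + 1) ^ I := by
            have := hgS y hy
            gcongr
        _ ≤ (C₁ + 1) * (2 * N + 1) ^ I * S := by
            have : 0 ≤ C₁ * ((2 * N + 1) ^ I * S) := by positivity
            nlinarith
    · have := hgS y hy
      rw [hS'] at this ⊢
      rw [le_antisymm this (norm_nonneg _)]
      simp
  push Not at hsmall
  obtain ⟨hDN, hSne⟩ := hsmall
  have hSpos : 0 < S := lt_of_le_of_ne hS0 hSne.symm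
  obtain ⟨n, hn0, hnD, hnr⟩ := exists_pow_le_and_sqrt_le hI (by omega) hIr hDN
  have hn0' : (0 : ℝ) < n := by exact_mod_cast hn0
  obtain ⟨p, hpd, hp0, hp1, hpm⟩ := hker n hn0
  set f₀ : EuclideanSpace ℝ (Fin I) → PiLp 1 (fun _ : Fin D => ℝ) := fun x => χ x • g x with hf₀
  have hf₀c : ContDiff ℝ r f₀ := contDiff_cutoff_smul hΩ hχ hχΩ hg
  have hf₀b : ∀ x, ‖iteratedFDeriv ℝ r f₀ x‖ ≤ 2 ^ r * B * S :=
    norm_iteratedFDeriv_cutoff_smul_le hΩ hχ hχΩ hg hB0 hS0 hB hSg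
  have hsupp : ∀ s : Fin I → ℝ, (f₀ ∘ T) s ≠ 0 → ∀ i, |s i| ≤ R := fun s hs i => by
    have : T s ∈ tsupport χ := subset_tsupport χ fun h => hs (by simp [hf₀, h])
    exact hR _ this i
  have hdiff : ∀ x t, ‖(fwdDiff t)^[r] (f₀ ∘ T) x‖ ≤ 2 ^ r * B * S * A ^ r * ‖t‖ ^ r := by
    intro x t
    have e : (fwdDiff t)^[r] (f₀ ∘ T) x = (fwdDiff (T t))^[r] f₀ (T x) := by
      simp only [fwdDiff_iter_eq_sum_shift, Function.comp_apply, map_add, map_nsmul]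
    rw [e]
    refine (norm_fwdDiff_iter_le (T t) r hf₀c hf₀b (T x)).trans ?_
    rw [mul_assoc _ (A ^ r), ← mul_pow]
    have := hTA t
    gcongr
  obtain ⟨q, hq⟩ := exists_polynomial_approx_of_kernel (hf₀c.continuous.comp T.continuous) hR0 hsupp
    (by positivity) hdiff hpd hp0 hp1
  -- The tolerance matches the polynomial error and accounts for the `+ 1` in `C₁ + 1`.
  obtain ⟨w, b, a, hnet⟩ := exists_tanh_sum_approx q R (ε := S / (n : ℝ) ^ r) (by positivity)
  obtain ⟨f, hf⟩ := exists_denseNetwork_eval_eq_sum (D := D) (by simpa using hnD) w b a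
  refine ⟨f, fun y hy => ?_⟩
  have hyR : ∀ i, |y i| ≤ R := hR y (subset_tsupport χ (by simp [hχK y hy]))
  have h1 := hq (WithLp.ofLp y) hyR
  have h2 := hnet (WithLp.ofLp y) hyR
  have h3 : (f₀ ∘ T) (WithLp.ofLp y) = g y := by
    change χ y • g y = g y
    rw [hχK y hy, one_smul]
  rw [h3, Fintype.card_fin] at h1
  have h4 : ‖g y - f.eval y‖ ≤ 2 ^ r * B * S * A ^ r * (2 * R) ^ r * (I * (C / (n : ℝ) ^ r)) +
      S / (n : ℝ) ^ r := by
    rw [hf]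
    refine (norm_sub_le_norm_sub_add_norm_sub _ _ _).trans (add_le_add (h1.trans ?_) h2)
    gcongr
  calc ‖g y - f.eval y‖ ≤ (C₁ + 1) * S / (n : ℝ) ^ r := by
        refine h4.trans_eq ?_
        rw [hC₁]
        ring
    _ ≤ (C₁ + 1) * (2 * N + 1) ^ I * S / Real.sqrt D := by
        rw [div_le_div_iff₀ (by positivity) hsq]
        calc (C₁ + 1) * S * Real.sqrt D
            ≤ (C₁ + 1) * S * ((2 * N + 1) ^ I * (n : ℝ) ^ r) := by gcongr
          _ = _ := by ring

theorem theorem2 (I : ℕ) (K Ω : Set (EuclideanSpace ℝ (Fin I)))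
    (hK : IsCompact K) (hΩ : IsOpen Ω) (hKΩ : K ⊆ Ω) :
    ∃ c : ℝ, 0 < c ∧
      ∀ (D : ℕ), 0 < D →
      ∀ (H : Matrix.unitaryGroup (Bits D) ℂ)
        (z : EuclideanSpace ℝ (Fin I) → Fin D → EuclideanSpace ℂ (Fin 2))
        (target : EuclideanSpace ℝ (Fin I) → PiLp 1 (fun _ : Fin D => ℝ)),
        (∀ y ∈ Ω, ∀ d, ‖z y d‖ = 1) →
        (∀ y ∈ Ω, target y ∈
          encodingPreimage ((H⁻¹ : Matrix.unitaryGroup (Bits D) ℂ).1 *ᵥ productState (z y))) →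
        ContDiffOn ℝ ((I / 2 + 2 : ℕ) : WithTop ℕ∞) target Ω →
        smoothnessNorm (I / 2 + 2) Ω target < ⊤ →
        ∃ f_dense : DenseNetwork I D, ∀ y ∈ K,
          ‖target y - f_dense.eval y‖ ≤
            c * (smoothnessNorm (I / 2 + 2) Ω target).toReal / Real.sqrt D := by

  -- For `I = 0` the input space is a point and a constant network is exact.
  rcases Nat.eq_zero_or_pos I with rfl | hI
  · refine ⟨1, one_pos, fun D _ _ _ target _ _ _ _ => ?_⟩
    obtain ⟨f, hf⟩ := exists_denseNetwork_const 0 D (target 0)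
    refine ⟨f, fun y _ => ?_⟩
    rw [hf, Subsingleton.elim y 0, sub_self, norm_zero]
    positivity
  · obtain ⟨c, hc, h⟩ := exists_denseNetwork_approx hI (by omega : I ≤ 2 * (I / 2 + 2)) hK hΩ hKΩ
    exact ⟨c, hc, fun D hD _ _ target _ _ hsmooth hfin => h D hD target hsmooth hfin⟩
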